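/- Let $\mathbb{K}=\mathbb{R}$ or $\mathbb{C}$, let $m\ge 3$, and let $p_1,\dots,p_m\in(1,\infty]$ (with $1/\infty=0$) be such that $$\frac12\le\frac1{p_1}+\frac1{p_2}<1\qquad\text{and}\qquad \frac1{p_1}+\cdots+\frac1{p_m}<1 .$$ For a positive integer $n$ and $p\in[1,\infty]$ let $\ell_p^n$ be $\mathbb{K}^n$ with the $p$-norm and canonical unit vectors $e_1,\dots,e_n$. For an $m$-linear form $T:\ell_{p_1}^n\times\cdots\times\ell_{p_m}^n\to\mathbb{K}$ let $\|T\|$ be the least $C\ge 0$ such that $|T(x_1,\dots,x_m)|\le C\,\|x_1\|_{p_1}\cdots\|x_m\|_{p_m}$ for all $x_1,\dots,x_m$. Put $$s=\frac{1}{1-\left(\frac1{p_1}+\cdots+\frac1{p_{m-1}}\right)},\qquad r=\frac{1}{1-\left(\frac1{p_1}+\cdots+\frac1{p_m}\right)} .$$ Then $$\left(\sum_{j_m=1}^{n}\left(\sum_{j_1,\dots,j_{m-1}=1}^{n}\left|T(e_{j_1},\dots,e_{j_m})\right|^{s}\right)^{\frac{r}{s}}\right)^{\frac1r}\le 2^{\,1-\left(\frac1{p_1}+\frac1{p_2}\right)}\,\|T\|$$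 for all positive integers $n$ and all $m$-linear forms $T:\ell_{p_1}^n\times\cdots\times\ell_{p_m}^n\to\mathbb{K}$. -/

import Mathlib

/-- The real number `1 / p` for `p ∈ [1, ∞]`, with the convention `1 / ∞ = 0`. -/
noncomputable def recip (p : ENNReal) : ℝ := (p⁻¹).toReal

/-- The space `ℓ_p^n`: the `n`-tuples of scalars with the `p`-norm. -/
abbrev EllP (𝕜 : Type*) (p : ENNReal) (n : ℕ) : Type _ := PiLp p (fun _ : Fin n => 𝕜)

/-- The `k`-th canonical unit vector `e_k` of `ℓ_p^n`. -/
noncomputable def unitVec (𝕜 : Type*) [RCLike 𝕜] (p : ENNReal) (n : ℕ) (k : Fin n) :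
    EllP 𝕜 p n :=
  WithLp.toLp p (Pi.single k 1)

/-- Multilinear forms on `ℓ_{p_1}^n × ⋯ × ℓ_{p_m}^n` are automatically continuous. -/
theorem multilinear_continuous {𝕜 : Type*} [RCLike 𝕜] {m n : ℕ} (p : Fin m → ENNReal)
    [∀ i, Fact (1 ≤ p i)] (T : MultilinearMap 𝕜 (fun i => EllP 𝕜 (p i) n) 𝕜) :
    Continuous T := by
  have hx : ∀ x : (i : Fin m) → EllP 𝕜 (p i) n,
      T x = ∑ j : Fin m → Fin n,
        (∏ i, x i (j i)) * T (fun i => unitVec 𝕜 (p i) n (j i)) := by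
    intro x
    have h : x = fun i => ∑ k : Fin n, x i k • unitVec 𝕜 (p i) n k := by
      funext i
      ext l
      simp [unitVec, Pi.single_apply]
    conv_lhs => rw [h]
    rw [T.map_sum]
    refine Finset.sum_congr rfl fun j _ => ?_
    rw [T.map_smul_univ (fun i => x i (j i)) (fun i => unitVec 𝕜 (p i) n (j i)), smul_eq_mul]
  rw [show (T : ((i : Fin m) → EllP 𝕜 (p i) n) → 𝕜) = _ from funext hx]
  fun_prop

/-- A multilinear form on `ℓ_{p_1}^n × ⋯ × ℓ_{p_m}^n`, regarded as a continuous one. Its norm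
in Mathlib is the usual `‖T‖`: the least `C ≥ 0` with `|T(x_1, …, x_m)| ≤ C ‖x_1‖ ⋯ ‖x_m‖`. -/
def contForm {𝕜 : Type*} [RCLike 𝕜] {m n : ℕ} (p : Fin m → ENNReal)
    [∀ i, Fact (1 ≤ p i)] (T : MultilinearMap 𝕜 (fun i => EllP 𝕜 (p i) n) 𝕜) :
    ContinuousMultilinearMap 𝕜 (fun i => EllP 𝕜 (p i) n) 𝕜 :=
  ⟨T, multilinear_continuous p T⟩

/-! ### Elementary inequalities for finite sums -/

/-! The unit balls enter only through `‖x k‖ ≤ D k ^ w` with `w = 1 / p`; since `0 ^ 0 = 1`, this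
also covers `p = ∞`. All the estimates come from testing the form on vectors built from its own
coefficients, which gives `N ≤ K * N ^ θ` with `θ < 1`, and absorbing (`le_rpow_of_le_mul_rpow`).

An `ℓ_s` bound with `s ≥ 2` passes to one more variable without loss: random signs in that variable
decouple its coordinates (`sum_rpow_sum_le_of_bound`). As `1 / p_1 + 1 / p_2 ≥ 1 / 2` forces `s ≥
2`, induction on the number of variables reduces everything to bilinear forms, the only source of
the constant.

With `u = 1 / p_1`, `v = 1 / p_2`: if one of them is at least `1 / 2`, duality and the same sign
argument give constant `1`. Otherwise Khinchine gives two weighted estimates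
(`BilinBound.sum_rpow_mul_le`), whose weights cancel in a geometric mean
(`BilinBound.sum_rpow_le_of_le_half`). -/

theorem sum_rpow_le_rpow_sum_of_one_le {ι : Type*} [Fintype ι] {f : ι → ℝ} (hf : ∀ i, 0 ≤ f i)
    {t : ℝ} (ht : 1 ≤ t) : ∑ i, f i ^ t ≤ (∑ i, f i) ^ t := by
  have hS : 0 ≤ ∑ i, f i := Finset.sum_nonneg fun i _ => hf i
  have key : ∀ x : ℝ, 0 ≤ x → x ^ t = x * x ^ (t - 1) := fun x hx => by
    conv_lhs => rw [show t = 1 + (t - 1) by ring]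
    rw [Real.rpow_add_of_nonneg hx (by norm_num) (by linarith), Real.rpow_one]
  rw [key _ hS, Finset.sum_mul]
  refine Finset.sum_le_sum fun i _ => ?_
  rw [key _ (hf i)]
  refine mul_le_mul_of_nonneg_left (Real.rpow_le_rpow (hf i) ?_ (by linarith)) (hf i)
  exact Finset.single_le_sum (fun i _ => hf i) (Finset.mem_univ i)

theorem sum_rpow_mul_rpow_le {ι : Type*} [Fintype ι] {f g : ι → ℝ} (hf : ∀ i, 0 ≤ f i)
    (hg : ∀ i, 0 ≤ g i) {α : ℝ} (h0 : 0 < α) (h1 : α < 1) :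
    ∑ i, f i ^ α * g i ^ (1 - α) ≤ (∑ i, f i) ^ α * (∑ i, g i) ^ (1 - α) := by
  have h1' : 0 < 1 - α := by linarith
  have hpq : Real.HolderConjugate (1 / α) (1 / (1 - α)) := by
    rw [Real.holderConjugate_iff]
    refine ⟨by rw [lt_div_iff₀ h0]; linarith, by simp⟩
  have := Real.inner_le_Lp_mul_Lq_of_nonneg Finset.univ hpq
    (f := fun i => f i ^ α) (g := fun i => g i ^ (1 - α))
    (fun i _ => Real.rpow_nonneg (hf i) _) (fun i _ => Real.rpow_nonneg (hg i) _)
  simpa [← Real.rpow_mul (hf _), ← Real.rpow_mul (hg _), mul_inv_cancel₀ h0.ne',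
    mul_inv_cancel₀ h1'.ne'] using this

/-! ### Rademacher sums -/

/-- The sign `1` or `-1` encoded by a Boolean. -/
def boolSign (𝕜 : Type*) [RCLike 𝕜] (b : Bool) : 𝕜 := if b then 1 else -1

theorem norm_boolSign {𝕜 : Type*} [RCLike 𝕜] (b : Bool) : ‖boolSign 𝕜 b‖ = 1 := by
  cases b <;> simp [boolSign]

/-- The signed sum `∑ k, ε k * c k`. -/
def radSum {𝕜 : Type*} [RCLike 𝕜] {n : ℕ} (c : Fin n → 𝕜) (ε : Fin n → Bool) : 𝕜 :=
  ∑ k, boolSign 𝕜 (ε k) * c k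

theorem sum_norm_radSum_succ {𝕜 : Type*} [RCLike 𝕜] {n : ℕ} (c : Fin (n + 1) → 𝕜) (F : ℝ → ℝ) :
    ∑ ε, F ‖radSum c ε‖ = ∑ ε, (F ‖radSum (fun k => c k.succ) ε + c 0‖ +
      F ‖radSum (fun k => c k.succ) ε - c 0‖) := by
  rw [← (Fin.consEquiv fun _ => Bool).sum_comp, Fintype.sum_prod_type, Fintype.sum_bool,
    ← Finset.sum_add_distrib]
  refine Finset.sum_congr rfl fun ε _ => ?_
  congr 3 <;> simp [radSum, Fin.sum_univ_succ, boolSign, Fin.consEquiv] <;> ring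

theorem sum_norm_radSum_sq {𝕜 : Type*} [RCLike 𝕜] {n : ℕ} (c : Fin n → 𝕜) :
    ∑ ε, ‖radSum c ε‖ ^ 2 = 2 ^ n * ∑ k, ‖c k‖ ^ 2 := by
  induction n with
  | zero => simp [radSum]
  | succ n ih =>
    rw [sum_norm_radSum_succ c fun t => t ^ 2]
    simp only [parallelogram_law_with_norm 𝕜, ← Finset.mul_sum, Finset.sum_add_distrib, ih]
    simp [Fin.sum_univ_succ]
    ring

theorem norm_add_pow_four_add_norm_sub_pow_four_le {𝕜 : Type*} [RCLike 𝕜] (x y : 𝕜) :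
    ‖x + y‖ ^ 4 + ‖x - y‖ ^ 4 ≤ 2 * (‖x‖ ^ 4 + 6 * (‖x‖ ^ 2 * ‖y‖ ^ 2) + ‖y‖ ^ 4) := by
  have h1 := norm_add_sq (𝕜 := 𝕜) x y
  have h2 := norm_sub_sq (𝕜 := 𝕜) x y
  have h3 : (RCLike.re (inner 𝕜 x y)) ^ 2 ≤ (‖x‖ * ‖y‖) ^ 2 := by
    refine sq_le_sq' ?_ (re_inner_le_norm x y)
    exact (abs_le.1 ((RCLike.abs_re_le_norm _).trans (norm_inner_le_norm x y))).1
  have e1 : ‖x + y‖ ^ 4 = (‖x + y‖ ^ 2) ^ 2 := by ring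
  have e2 : ‖x - y‖ ^ 4 = (‖x - y‖ ^ 2) ^ 2 := by ring
  rw [e1, e2, h1, h2]
  nlinarith [h3]

theorem sum_norm_radSum_pow_four_le {𝕜 : Type*} [RCLike 𝕜] {n : ℕ} (c : Fin n → 𝕜) :
    ∑ ε, ‖radSum c ε‖ ^ 4 ≤ 2 ^ n * (3 * (∑ k, ‖c k‖ ^ 2) ^ 2) := by
  induction n with
  | zero => simp [radSum]
  | succ n ih =>
    rw [sum_norm_radSum_succ c fun t => t ^ 4]
    refine (Finset.sum_le_sum fun ε _ =>
      norm_add_pow_four_add_norm_sub_pow_four_le _ _).trans ?_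
    have h := ih fun k => c k.succ
    have h2 := sum_norm_radSum_sq fun k => c k.succ
    simp only [← Finset.mul_sum, Finset.sum_add_distrib, ← Finset.sum_mul, h2]
    simp only [Finset.sum_const, Finset.card_univ, Fintype.card_pi, Fintype.card_bool,
      Finset.prod_const, Fintype.card_fin, Fin.sum_univ_succ, nsmul_eq_mul]
    push_cast
    rw [pow_succ (2 : ℝ) n]
    -- The constant `3` makes the cross terms agree exactly; the only slack is a multiple of this
    -- term.
    have h4 : (0 : ℝ) ≤ 2 ^ n * ‖c 0‖ ^ 4 := by positivity
    nlinarith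

theorem rpow_sum_sq_le_sum_norm_radSum {𝕜 : Type*} [RCLike 𝕜] {n : ℕ} (c : Fin n → 𝕜) {s : ℝ}
    (hs : 2 ≤ s) : 2 ^ n * (∑ k, ‖c k‖ ^ 2) ^ (s / 2) ≤ ∑ ε, ‖radSum c ε‖ ^ s := by
  have h := Real.rpow_arith_mean_le_arith_mean_rpow Finset.univ
    (fun _ : Fin n → Bool => ((2 : ℝ) ^ n)⁻¹) (fun ε => ‖radSum c ε‖ ^ 2)
    (fun _ _ => by positivity) (by simp) (fun _ _ => by positivity)
    (p := s / 2) (by linarith)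
  simp only [← Finset.mul_sum, sum_norm_radSum_sq] at h
  rw [inv_mul_cancel_left₀ (by positivity), ← div_eq_inv_mul, le_div_iff₀' (by positivity)] at h
  refine h.trans_eq (Finset.sum_congr rfl fun ε _ => ?_)
  rw [← Real.rpow_natCast, ← Real.rpow_mul (norm_nonneg _)]
  congr 1
  push_cast
  ring

/-- Jensen from the exact second moment, then `ℓ_2 ⊆ ℓ_s`; neither costs a constant. -/
theorem sum_rpow_le_sum_norm_radSum {𝕜 : Type*} [RCLike 𝕜] {n : ℕ} (c : Fin n → 𝕜) {s : ℝ}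
    (hs : 2 ≤ s) : 2 ^ n * ∑ k, ‖c k‖ ^ s ≤ ∑ ε, ‖radSum c ε‖ ^ s := by
  refine le_trans (mul_le_mul_of_nonneg_left ?_ (by positivity))
    (rpow_sum_sq_le_sum_norm_radSum c hs)
  refine le_trans (Finset.sum_le_sum fun k _ => ?_) (sum_rpow_le_rpow_sum_of_one_le
    (fun k => sq_nonneg ‖c k‖) (t := s / 2) (by linarith))
  rw [← Real.rpow_natCast, ← Real.rpow_mul (norm_nonneg _)]
  refine le_of_eq (congrArg _ ?_)
  push_cast
  ring

/-- Hölder interpolates the second moment, known exactly, between the `q`-th and the fourth, which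
is at most `3` times the square of the second. The constant is not sharp but suffices. -/
theorem khinchine {𝕜 : Type*} [RCLike 𝕜] {n : ℕ} (c : Fin n → 𝕜) {q : ℝ} (h0 : 0 < q)
    (hq : q ≤ 2) :
    2 ^ n * (∑ k, ‖c k‖ ^ 2) ^ (q / 2) ≤ 3 ^ ((2 - q) / 2) * ∑ ε, ‖radSum c ε‖ ^ q := by
  rcases hq.eq_or_lt with rfl | hq
  · simp [sum_norm_radSum_sq]
  set σ := ∑ k, ‖c k‖ ^ 2 with hσ
  have hσ0 : 0 ≤ σ := by positivity
  have hR : 0 ≤ ∑ ε, ‖radSum c ε‖ ^ q := by positivity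
  rcases hσ0.eq_or_lt with h | hσ0
  · rw [← h, Real.zero_rpow (by linarith)]
    simpa using by positivity
  have h4 : 0 < 4 - q := by linarith
  have hα : 0 < 2 / (4 - q) := by positivity
  have hα1 : 2 / (4 - q) < 1 := by rw [div_lt_one h4]; linarith
  have H := sum_rpow_mul_rpow_le (f := fun ε => ‖radSum c ε‖ ^ q)
    (g := fun ε => ‖radSum c ε‖ ^ 4) (fun _ => by positivity) (fun _ => by positivity) hα hα1
  have e : ∀ t : ℝ, 0 ≤ t → (t ^ q) ^ (2 / (4 - q)) * (t ^ 4) ^ (1 - 2 / (4 - q)) = t ^ 2 := by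
    intro t ht
    rw [← Real.rpow_natCast t 4, ← Real.rpow_mul ht, ← Real.rpow_mul ht,
      ← Real.rpow_add_of_nonneg ht (by positivity)
        (mul_nonneg (by norm_num) (by linarith)), ← Real.rpow_natCast]
    congr 1
    push_cast
    field_simp
    ring
  simp only [e _ (norm_nonneg _), sum_norm_radSum_sq] at H
  rw [← hσ] at H
  have H2 : 2 ^ n * σ ≤ (∑ ε, ‖radSum c ε‖ ^ q) ^ (2 / (4 - q)) *
      (2 ^ n * (3 * σ ^ 2)) ^ (1 - 2 / (4 - q)) :=
    H.trans (mul_le_mul_of_nonneg_left (Real.rpow_le_rpow (by positivity)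
      (sum_norm_radSum_pow_four_le c) (by linarith)) (by positivity))
  -- This power makes the exponent of the `q`-th moment equal to `1`; cancelling `σ ^ (2 - q)` then
  -- leaves `σ ^ (q / 2)`.
  have H3 := Real.rpow_le_rpow (by positivity) H2 (z := (4 - q) / 2) (by positivity)
  rw [Real.mul_rpow (by positivity) (by positivity),
    Real.mul_rpow (by positivity) (by positivity), ← Real.rpow_mul hR,
    ← Real.rpow_mul (by positivity), show 2 / (4 - q) * ((4 - q) / 2) = 1 by field_simp,
    show (1 - 2 / (4 - q)) * ((4 - q) / 2) = (2 - q) / 2 by field_simp; ring, Real.rpow_one,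
    show (4 - q) / 2 = 1 + (2 - q) / 2 by ring, Real.rpow_add (by positivity), Real.rpow_one,
    Real.mul_rpow (by positivity) (by positivity), Real.mul_rpow (by positivity) (by positivity),
    ← Real.rpow_natCast σ 2, ← Real.rpow_mul hσ0.le,
    show ((2 : ℕ) : ℝ) * ((2 - q) / 2) = (2 - q) / 2 + (2 - q) / 2 by push_cast; ring,
    Real.rpow_add hσ0, Real.rpow_add hσ0, Real.rpow_one] at H3
  have e2 : σ = σ ^ (q / 2) * σ ^ ((2 - q) / 2) := by
    rw [← Real.rpow_add hσ0, show q / 2 + (2 - q) / 2 = 1 by ring, Real.rpow_one]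
  have hpos : 0 < ((2 : ℝ) ^ n) ^ ((2 - q) / 2) * σ ^ ((2 - q) / 2) * σ ^ ((2 - q) / 2) := by
    positivity
  refine le_of_mul_le_mul_right ?_ hpos
  have h5 : 2 ^ n * σ ^ (q / 2) *
      (((2 : ℝ) ^ n) ^ ((2 - q) / 2) * σ ^ ((2 - q) / 2) * σ ^ ((2 - q) / 2)) =
      2 ^ n * ((2 : ℝ) ^ n) ^ ((2 - q) / 2) *
        (σ ^ (q / 2) * σ ^ ((2 - q) / 2) * σ ^ ((2 - q) / 2)) := by ring
  rw [h5, ← e2]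
  linarith

/-! ### Duality and the passage from one variable to two -/

theorem le_rpow_of_le_mul_rpow {N M w : ℝ} (hN : 0 ≤ N) (hM : 0 ≤ M) (hw : w < 1)
    (h : N ≤ M * N ^ w) : N ≤ M ^ (1 / (1 - w)) := by
  have hw' : 0 < 1 - w := by linarith
  rcases hN.eq_or_lt with rfl | hN
  · positivity
  have h1 : N ^ (1 - w) ≤ M := by
    rw [Real.rpow_sub hN, Real.rpow_one, div_le_iff₀ (by positivity)]
    exact h
  calc N = (N ^ (1 - w)) ^ (1 / (1 - w)) := by
        rw [← Real.rpow_mul hN.le, mul_one_div_cancel hw'.ne', Real.rpow_one]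
    _ ≤ _ := Real.rpow_le_rpow (by positivity) h1 (by positivity)

/-- Duality of `ℓ_{1/u}` and `ℓ_{1/(1-u)}`, by testing on the extremal vector: the conjugate phase
of `c i` times a power of its modulus. -/
theorem sum_rpow_le_of_linear_bound {𝕜 : Type*} [RCLike 𝕜] {ι : Type*} [Fintype ι] (c : ι → 𝕜)
    {u M : ℝ} (hu : 0 ≤ u) (hu1 : u < 1) (hM : 0 ≤ M)
    (h : ∀ (y : ι → 𝕜) (E : ι → ℝ), (∀ i, 0 ≤ E i) → (∀ i, ‖y i‖ ≤ E i ^ u) →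
      ‖∑ i, y i * c i‖ ≤ M * (∑ i, E i) ^ u) :
    ∑ i, ‖c i‖ ^ (1 / (1 - u)) ≤ M ^ (1 / (1 - u)) := by
  have hu' : 0 < 1 - u := by linarith
  refine le_rpow_of_le_mul_rpow (by positivity) hM hu1 ?_
  have hphase : ∀ i, ∃ z : 𝕜, ‖z‖ ≤ 1 ∧ z * c i = (‖c i‖ : 𝕜) := by
    intro i
    by_cases h0 : c i = 0
    · exact ⟨0, by simp, by simp [h0]⟩
    · have h0' : (‖c i‖ : 𝕜) ≠ 0 := by simpa using h0
      refine ⟨(‖c i‖ : 𝕜) / c i, by simp [h0], div_mul_cancel₀ _ h0⟩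
  choose z hz1 hz2 using hphase
  have H := h (fun i => (((‖c i‖ ^ (1 / (1 - u))) ^ u : ℝ) : 𝕜) * z i)
    (fun i => ‖c i‖ ^ (1 / (1 - u))) (fun i => by positivity) (fun i => by
      rw [norm_mul, RCLike.norm_ofReal, abs_of_nonneg (by positivity)]
      exact mul_le_of_le_one_right (by positivity) (hz1 i))
  have e : ∑ i, (((‖c i‖ ^ (1 / (1 - u))) ^ u : ℝ) : 𝕜) * z i * c i =
      ((∑ i, ‖c i‖ ^ (1 / (1 - u)) : ℝ) : 𝕜) := by
    push_cast
    refine Finset.sum_congr rfl fun i _ => ?_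
    rw [mul_assoc, hz2, ← RCLike.ofReal_mul, ← Real.rpow_mul (norm_nonneg _)]
    congr 1
    conv_lhs => rw [← Real.rpow_one ‖c i‖]
    rw [← Real.rpow_mul (norm_nonneg _), one_mul, ← Real.rpow_add_of_nonneg (norm_nonneg _)
      (by positivity) (by norm_num)]
    congr 1
    field_simp
    ring
  rwa [e, RCLike.norm_ofReal, abs_of_nonneg (by positivity)] at H

theorem sum_rpow_sum_le_of_bound {𝕜 : Type*} [RCLike 𝕜] {ι : Type*} [Fintype ι] {n : ℕ}
    (a : ι → Fin n → 𝕜) {s w M : ℝ} (hs : 2 ≤ s) (hw : 0 ≤ w) (hsw : w * s < 1) (hM : 0 ≤ M)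
    (h : ∀ (x : Fin n → 𝕜) (D : Fin n → ℝ), (∀ k, 0 ≤ D k) → (∀ k, ‖x k‖ ≤ D k ^ w) →
      ∑ i, ‖∑ k, x k * a i k‖ ^ s ≤ (M * (∑ k, D k) ^ w) ^ s) :
    ∑ k, (∑ i, ‖a i k‖ ^ s) ^ (1 / (1 - w * s)) ≤ (M ^ s) ^ (1 / (1 - w * s)) := by
  have hsw' : 0 < 1 - w * s := by linarith
  set b : Fin n → ℝ := fun k => ∑ i, ‖a i k‖ ^ s with hb
  have hb0 : ∀ k, 0 ≤ b k := fun k => by positivity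
  -- Chosen so that `D k ^ (w * s) * b k = D k`: the tested sum reproduces `∑ k, D k`.
  set D : Fin n → ℝ := fun k => b k ^ (1 / (1 - w * s)) with hD
  have hD0 : ∀ k, 0 ≤ D k := fun k => by positivity
  have hS : 0 ≤ ∑ k, D k := Finset.sum_nonneg fun k _ => hD0 k
  refine le_rpow_of_le_mul_rpow hS (by positivity) hsw ?_
  set c : ι → Fin n → 𝕜 := fun i k => ((D k ^ w : ℝ) : 𝕜) * a i k with hc
  have h1 : ∑ ε : Fin n → Bool, ∑ i, ‖radSum (c i) ε‖ ^ s ≤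
      ∑ ε : Fin n → Bool, (M * (∑ k, D k) ^ w) ^ s := by
    refine Finset.sum_le_sum fun ε _ => ?_
    have := h (fun k => boolSign 𝕜 (ε k) * ((D k ^ w : ℝ) : 𝕜)) D hD0 fun k => by
      rw [norm_mul, norm_boolSign, one_mul, RCLike.norm_ofReal,
        abs_of_nonneg (Real.rpow_nonneg (hD0 k) _)]
    simpa only [radSum, hc, mul_assoc] using this
  rw [Finset.sum_comm] at h1
  have h2 := (Finset.sum_le_sum fun i _ => sum_rpow_le_sum_norm_radSum (c i) hs).trans h1
  rw [← Finset.mul_sum, Finset.sum_comm] at h2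
  simp only [Finset.sum_const, Finset.card_univ, Fintype.card_pi, Fintype.card_bool,
    Finset.prod_const, Fintype.card_fin, nsmul_eq_mul] at h2
  push_cast at h2
  have h3 := le_of_mul_le_mul_left h2 (by positivity)
  rw [Real.mul_rpow hM (by positivity), ← Real.rpow_mul hS] at h3
  refine le_trans (le_of_eq (Finset.sum_congr rfl fun k _ => ?_)) h3
  have : ∀ i, ‖c i k‖ ^ s = D k ^ (w * s) * ‖a i k‖ ^ s := fun i => by
    rw [hc, norm_mul, RCLike.norm_ofReal, abs_of_nonneg (Real.rpow_nonneg (hD0 k) _),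
      Real.mul_rpow (Real.rpow_nonneg (hD0 k) _) (norm_nonneg _), ← Real.rpow_mul (hD0 k)]
  simp only [this, ← Finset.mul_sum]
  change D k = D k ^ (w * s) * b k
  have e : b k = D k ^ (1 - w * s) := by
    rw [hD, ← Real.rpow_mul (hb0 k), one_div_mul_cancel hsw'.ne', Real.rpow_one]
  rw [e, ← Real.rpow_add_of_nonneg (hD0 k) (by positivity) hsw'.le]
  simp

/-! ### Bilinear forms -/

/-- The bilinear form with matrix `a` is bounded by `M` on `ℓ_{1/u} × ℓ_{1/v}`. -/
def BilinBound {𝕜 : Type*} [RCLike 𝕜] {n : ℕ} (a : Fin n → Fin n → 𝕜) (u v M : ℝ) : Prop :=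
  ∀ (y : Fin n → 𝕜) (E : Fin n → ℝ) (x : Fin n → 𝕜) (D : Fin n → ℝ),
    (∀ i, 0 ≤ E i) → (∀ i, ‖y i‖ ≤ E i ^ u) → (∀ k, 0 ≤ D k) → (∀ k, ‖x k‖ ≤ D k ^ v) →
      ‖∑ i, ∑ k, y i * x k * a i k‖ ≤ M * (∑ i, E i) ^ u * (∑ k, D k) ^ v

section Bilinear

variable {𝕜 : Type*} [RCLike 𝕜] {n : ℕ} {a : Fin n → Fin n → 𝕜} {u v M : ℝ}

theorem BilinBound.symm (h : BilinBound a u v M) : BilinBound (fun k i => a i k) v u M := by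
  intro x D y E hD hx hE hy
  rw [Finset.sum_comm, mul_right_comm]
  simpa only [mul_comm (x _)] using h y E x D hE hy hD hx

theorem BilinBound.sum_norm_rpow_le (h : BilinBound a u v M) (hM : 0 ≤ M) (hv : 0 ≤ v)
    (hv1 : v < 1) {y : Fin n → 𝕜} {E : Fin n → ℝ} (hE : ∀ i, 0 ≤ E i)
    (hy : ∀ i, ‖y i‖ ≤ E i ^ u) :
    ∑ k, ‖∑ i, y i * a i k‖ ^ (1 / (1 - v)) ≤ (M * (∑ i, E i) ^ u) ^ (1 / (1 - v)) := by
  have hS : 0 ≤ ∑ i, E i := Finset.sum_nonneg fun i _ => hE i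
  refine sum_rpow_le_of_linear_bound _ hv hv1 (by positivity) fun x D hD hx => ?_
  refine le_trans (le_of_eq ?_) (h y E x D hE hy hD hx)
  rw [Finset.sum_comm]
  congr 1
  refine Finset.sum_congr rfl fun k _ => ?_
  rw [Finset.mul_sum]
  exact Finset.sum_congr rfl fun i _ => by ring

/-- Duality in the second variable yields the exponent `1 / (1 - v) ≥ 2`, so random signs in the
first lose nothing. -/
theorem BilinBound.sum_rpow_le_of_half_le (h : BilinBound a u v M) (hM : 0 ≤ M) (hu : 0 ≤ u)
    (hv : 1 / 2 ≤ v) (huv : u + v < 1) :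
    ∑ i, ∑ k, ‖a i k‖ ^ (1 / (1 - u - v)) ≤ M ^ (1 / (1 - u - v)) := by
  have hv1 : 0 < 1 - v := by linarith
  have huv' : 0 < 1 - u - v := by linarith
  have hsw : u * (1 / (1 - v)) < 1 := by
    rw [mul_one_div, div_lt_one hv1]
    linarith
  have hsw' : 0 < 1 - u * (1 / (1 - v)) := by linarith
  have e : 1 / (1 - v) * (1 / (1 - u * (1 / (1 - v)))) = 1 / (1 - u - v) := by
    have : 1 - v - u ≠ 0 := by linarith
    field_simp
    ring
  have H := sum_rpow_sum_le_of_bound (fun k i => a i k) (s := 1 / (1 - v)) (w := u) (M := M)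
    (by rw [le_div_iff₀ hv1]; linarith) hu hsw hM
    fun y E hE hy => h.sum_norm_rpow_le hM (by linarith) (by linarith) hE hy
  rw [← Real.rpow_mul hM, e] at H
  refine le_trans (Finset.sum_le_sum fun i _ => ?_) H
  refine le_trans (le_of_eq (Finset.sum_congr rfl fun k _ => ?_))
    (sum_rpow_le_rpow_sum_of_one_le (fun k => by positivity)
      (t := 1 / (1 - u * (1 / (1 - v)))) ?_)
  · rw [← Real.rpow_mul (norm_nonneg _), e]
  · rw [le_div_iff₀ hsw']
    have : 0 ≤ u * (1 / (1 - v)) := by positivity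
    linarith

/-- Here `1 / (1 - v) ≤ 2`, so Khinchine applies to the test vectors with entries `± R i ^ u`, `R i`
being the row sums. Cauchy–Schwarz in `i` and Hölder in `k` turn the resulting square functions `Q
k` into this weighted sum. -/
theorem BilinBound.sum_rpow_mul_le (h : BilinBound a u v M) (hM : 0 ≤ M) (hu : 0 < u)
    (hv : 0 < v) (hv2 : v ≤ 1 / 2) (huv : 1 / 2 ≤ u + v) (huv1 : u + v < 1) :
    ∑ k, ∑ i, ‖a i k‖ ^ (1 / (1 - u - v)) *
        ((∑ k, ‖a i k‖ ^ (1 / (1 - u - v))) / ∑ i, ‖a i k‖ ^ (1 / (1 - u - v))) ^ u ≤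
      3 ^ (1 / 2 - v) * M * (∑ i, ∑ k, ‖a i k‖ ^ (1 / (1 - u - v))) ^ (u + v) := by
  have hv1 : 0 < 1 - v := by linarith
  have hl : 0 < 1 - u - v := by linarith
  set l := 1 / (1 - u - v) with hldef
  have hlpos : 0 < l := by positivity
  set R : Fin n → ℝ := fun i => ∑ k, ‖a i k‖ ^ l with hR
  set S : Fin n → ℝ := fun k => ∑ i, ‖a i k‖ ^ l with hS
  have hR0 : ∀ i, 0 ≤ R i := fun i => by positivity
  have hS0 : ∀ k, 0 ≤ S k := fun k => by positivity
  set N := ∑ i, R i with hN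
  have hN0 : 0 ≤ N := Finset.sum_nonneg fun i _ => hR0 i
  have hNS : ∑ k, S k = N := Finset.sum_comm
  set Q : Fin n → ℝ := fun k => ∑ i, (R i ^ u * ‖a i k‖) ^ 2 with hQ
  have hQ0 : ∀ k, 0 ≤ Q k := fun k => by positivity
  have hq2 : 1 / (1 - v) ≤ 2 := by rw [div_le_iff₀ hv1]; linarith
  have hkh : ∑ k, Q k ^ (1 / (1 - v) / 2) ≤
      3 ^ ((2 - 1 / (1 - v)) / 2) * (M * N ^ u) ^ (1 / (1 - v)) := by
    set c : Fin n → Fin n → 𝕜 := fun k i => ((R i ^ u : ℝ) : 𝕜) * a i k with hc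
    have hcn : ∀ k i, ‖c k i‖ = R i ^ u * ‖a i k‖ := fun k i => by
      rw [hc, norm_mul, RCLike.norm_ofReal, abs_of_nonneg (Real.rpow_nonneg (hR0 i) _)]
    have h1 : ∑ ε : Fin n → Bool, ∑ k, ‖radSum (c k) ε‖ ^ (1 / (1 - v)) ≤
        ∑ ε : Fin n → Bool, (M * N ^ u) ^ (1 / (1 - v)) := by
      refine Finset.sum_le_sum fun ε _ => ?_
      have := h.sum_norm_rpow_le hM hv.le (by linarith)
        (y := fun i => boolSign 𝕜 (ε i) * ((R i ^ u : ℝ) : 𝕜)) hR0 fun i => by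
          rw [norm_mul, norm_boolSign, one_mul, RCLike.norm_ofReal,
            abs_of_nonneg (Real.rpow_nonneg (hR0 i) _)]
      simpa only [radSum, hc, mul_assoc] using this
    rw [Finset.sum_comm] at h1
    have h2 := Finset.sum_le_sum fun k (_ : k ∈ Finset.univ) =>
      khinchine (c k) (q := 1 / (1 - v)) (by positivity) hq2
    rw [← Finset.mul_sum, ← Finset.mul_sum] at h2
    have h3 := h2.trans (mul_le_mul_of_nonneg_left h1 (by positivity))
    simp only [Finset.sum_const, Finset.card_univ, Fintype.card_pi, Fintype.card_bool,
      Finset.prod_const, Fintype.card_fin, nsmul_eq_mul, hcn] at h3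
    push_cast at h3
    rw [mul_left_comm] at h3
    exact le_of_mul_le_mul_left h3 (by positivity)
  have hhol : ∑ k, S k ^ v * Q k ^ (1 / 2 : ℝ) ≤ 3 ^ (1 / 2 - v) * M * N ^ (u + v) := by
    have h1 := sum_rpow_mul_rpow_le hS0 (fun k => Real.rpow_nonneg (hQ0 k) (1 / (1 - v) / 2)) hv
      (by linarith)
    have e : ∀ k, (Q k ^ (1 / (1 - v) / 2)) ^ (1 - v) = Q k ^ (1 / 2 : ℝ) := fun k => by
      rw [← Real.rpow_mul (hQ0 k)]
      congr 1
      field_simp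
    simp only [e, hNS] at h1
    refine h1.trans ((mul_le_mul_of_nonneg_left (Real.rpow_le_rpow
      (Finset.sum_nonneg fun k _ => Real.rpow_nonneg (hQ0 k) _) hkh hv1.le)
      (by positivity)).trans_eq ?_)
    rw [Real.mul_rpow (by positivity) (by positivity), ← Real.rpow_mul (by norm_num),
      ← Real.rpow_mul (by positivity), one_div_mul_cancel hv1.ne', Real.rpow_one,
      Real.rpow_add_of_nonneg hN0 hu.le hv.le,
      show (2 - 1 / (1 - v)) / 2 * (1 - v) = 1 / 2 - v by field_simp; ring]
    ring
  refine le_trans (Finset.sum_le_sum fun k _ => ?_) hhol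
  rcases (hS0 k).eq_or_lt with hk | hk
  -- For an empty column the weight is `(R i / 0) ^ u = 0`, because `u > 0`.
  · refine le_trans (le_of_eq (Finset.sum_eq_zero fun i _ => ?_)) (by positivity)
    change ‖a i k‖ ^ l * (R i / S k) ^ u = 0
    rw [← hk, div_zero, Real.zero_rpow hu.ne', mul_zero]
  have hlu : l * (u + v) = l - 1 := by
    rw [hldef]
    field_simp
    ring
  have hl1 : 0 ≤ l - 1 := by rw [← hlu]; positivity
  have hcs := Real.sum_mul_le_sqrt_mul_sqrt Finset.univ (fun i => R i ^ u * ‖a i k‖)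
    (fun i => ‖a i k‖ ^ (l - 1))
  -- As `l - 1 = l * (u + v)`, this is `ℓ_1 ⊆ ℓ_{2(u+v)}` and needs `u + v ≥ 1 / 2`.
  have hb : √(∑ i, (‖a i k‖ ^ (l - 1)) ^ 2) ≤ S k ^ (u + v) := by
    refine Real.sqrt_le_iff.2 ⟨by positivity, ?_⟩
    have := sum_rpow_le_rpow_sum_of_one_le (f := fun i => ‖a i k‖ ^ l)
      (fun i => by positivity) (t := (u + v) * 2) (by linarith)
    refine (le_of_eq (Finset.sum_congr rfl fun i _ => ?_)).trans (this.trans_eq ?_)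
    · rw [← Real.rpow_natCast, ← Real.rpow_mul (norm_nonneg _), ← Real.rpow_mul (norm_nonneg _),
        ← mul_assoc, hlu]
      norm_num
    · rw [Real.rpow_mul (hS0 k)]
      norm_num [hS]
  have e : ∀ i, ‖a i k‖ ^ l * (R i / S k) ^ u =
      R i ^ u * ‖a i k‖ * ‖a i k‖ ^ (l - 1) / S k ^ u := fun i => by
    have : ‖a i k‖ ^ l = ‖a i k‖ * ‖a i k‖ ^ (l - 1) := by
      conv_lhs => rw [show l = 1 + (l - 1) by ring]
      rw [Real.rpow_add_of_nonneg (norm_nonneg _) (by norm_num) hl1, Real.rpow_one]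
    rw [Real.div_rpow (hR0 i) (hS0 k), this]
    ring
  calc ∑ i, ‖a i k‖ ^ l * (R i / S k) ^ u
      = (∑ i, R i ^ u * ‖a i k‖ * ‖a i k‖ ^ (l - 1)) / S k ^ u := by
        rw [Finset.sum_div]
        exact Finset.sum_congr rfl fun i _ => e i
    _ ≤ √(Q k) * S k ^ (u + v) / S k ^ u := by
        gcongr
        exact hcs.trans (mul_le_mul_of_nonneg_left hb (Real.sqrt_nonneg _))
    _ = S k ^ v * Q k ^ (1 / 2 : ℝ) := by
        rw [Real.rpow_add hk, Real.sqrt_eq_rpow]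
        field_simp

theorem BilinBound.sum_rpow_le_of_le_half (h : BilinBound a u v M) (hM : 0 ≤ M) (hu : 0 < u)
    (hv : 0 < v) (hu2 : u ≤ 1 / 2) (hv2 : v ≤ 1 / 2) (huv : 1 / 2 ≤ u + v) (huv1 : u + v < 1) :
    ∑ i, ∑ k, ‖a i k‖ ^ (1 / (1 - u - v)) ≤
      (2 ^ (1 - (u + v)) * M) ^ (1 / (1 - u - v)) := by
  have hl : 0 < 1 - u - v := by linarith
  have huv0 : 0 < u + v := by linarith
  have hA := h.sum_rpow_mul_le hM hu hv hv2 huv huv1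
  have hB := h.symm.sum_rpow_mul_le hM hv hu hu2 (by linarith) (by linarith)
  simp only [show 1 - v - u = 1 - u - v by ring, add_comm v u] at hB
  set l := 1 / (1 - u - v) with hldef
  have hlpos : 0 < l := by positivity
  rw [Finset.sum_comm (f := fun x y => ‖a y x‖ ^ l)] at hB
  rw [Finset.sum_comm] at hA
  set R : Fin n → ℝ := fun i => ∑ k, ‖a i k‖ ^ l with hR
  set S : Fin n → ℝ := fun k => ∑ i, ‖a i k‖ ^ l with hS
  have hR0 : ∀ i, 0 ≤ R i := fun i => by positivity
  have hS0 : ∀ k, 0 ≤ S k := fun k => by positivity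
  set N := ∑ i, R i with hN
  have hN0 : 0 ≤ N := Finset.sum_nonneg fun i _ => hR0 i
  rw [show 1 - u - v = 1 - (u + v) by ring] at hldef
  rw [hldef]
  refine le_rpow_of_le_mul_rpow hN0 (by positivity) huv1 ?_
  -- With exponents `v / (u + v)` and `u / (u + v)`, the weights `(R i / S k) ^ u` and `(S k / R i)
  -- ^ v` multiply to `1`.
  have hα : 0 < v / (u + v) := by positivity
  have hα1 : v / (u + v) < 1 := by rw [div_lt_one huv0]; linarith
  have hα' : 1 - v / (u + v) = u / (u + v) := by field_simp; ring
  have H := sum_rpow_mul_rpow_le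
    (f := fun ik : Fin n × Fin n => ‖a ik.1 ik.2‖ ^ l * (R ik.1 / S ik.2) ^ u)
    (g := fun ik : Fin n × Fin n => ‖a ik.1 ik.2‖ ^ l * (S ik.2 / R ik.1) ^ v)
    (fun ik => mul_nonneg (by positivity)
      (Real.rpow_nonneg (div_nonneg (hR0 _) (hS0 _)) _))
    (fun ik => mul_nonneg (by positivity)
      (Real.rpow_nonneg (div_nonneg (hS0 _) (hR0 _)) _)) hα hα1
  have e : ∀ i k, (‖a i k‖ ^ l * (R i / S k) ^ u) ^ (v / (u + v)) *
      (‖a i k‖ ^ l * (S k / R i) ^ v) ^ (1 - v / (u + v)) = ‖a i k‖ ^ l := by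
    intro i k
    rcases (norm_nonneg (a i k)).eq_or_lt with h0 | h0
    · rw [← h0, Real.zero_rpow hlpos.ne', zero_mul, Real.zero_rpow hα.ne', zero_mul]
    have hal : 0 < ‖a i k‖ ^ l := by positivity
    have hRi : 0 < R i := hal.trans_le
      (Finset.single_le_sum (f := fun k => ‖a i k‖ ^ l) (fun k _ => by positivity)
        (Finset.mem_univ k))
    have hSk : 0 < S k := hal.trans_le
      (Finset.single_le_sum (f := fun i => ‖a i k‖ ^ l) (fun i _ => by positivity)
        (Finset.mem_univ i))
    have hinv : S k / R i = (R i / S k)⁻¹ := by rw [inv_div]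
    have hpos : 0 < R i / S k := by positivity
    rw [hinv, Real.mul_rpow hal.le (by positivity), Real.mul_rpow hal.le (by positivity),
      Real.inv_rpow hpos.le, ← Real.rpow_neg hpos.le, ← Real.rpow_mul hpos.le,
      ← Real.rpow_mul hpos.le, mul_mul_mul_comm, ← Real.rpow_add hal, ← Real.rpow_add hpos, hα',
      show u * (v / (u + v)) + -v * (u / (u + v)) = 0 by ring,
      show v / (u + v) + u / (u + v) = 1 by field_simp; ring, Real.rpow_one, Real.rpow_zero,
      mul_one]
  simp only [e, Fintype.sum_prod_type] at H
  have hA0 : 0 ≤ ∑ i, ∑ k, ‖a i k‖ ^ l * (R i / S k) ^ u :=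
    Finset.sum_nonneg fun i _ => Finset.sum_nonneg fun k _ => mul_nonneg (by positivity)
      (Real.rpow_nonneg (div_nonneg (hR0 _) (hS0 _)) _)
  have hB0 : 0 ≤ ∑ i, ∑ k, ‖a i k‖ ^ l * (S k / R i) ^ v :=
    Finset.sum_nonneg fun i _ => Finset.sum_nonneg fun k _ => mul_nonneg (by positivity)
      (Real.rpow_nonneg (div_nonneg (hS0 _) (hR0 _)) _)
  -- The exponent is `1 / 2 - (u ^ 2 + v ^ 2) / (u + v)`, at most `(1 - (u + v)) / 2`; then `3 ≤ 4 =
  -- 2 ^ 2`.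
  have hconst : (3 : ℝ) ^ ((1 / 2 - v) * (v / (u + v)) + (1 / 2 - u) * (1 - v / (u + v))) ≤
      2 ^ (1 - (u + v)) := by
    have h1 : (1 / 2 - v) * (v / (u + v)) + (1 / 2 - u) * (1 - v / (u + v)) ≤
        (1 - (u + v)) / 2 := by
      rw [hα', ← mul_div_assoc, ← mul_div_assoc, ← add_div, div_le_iff₀ huv0]
      nlinarith [sq_nonneg (u - v)]
    calc _ ≤ (3 : ℝ) ^ ((1 - (u + v)) / 2) := Real.rpow_le_rpow_of_exponent_le (by norm_num) h1
      _ ≤ (4 : ℝ) ^ ((1 - (u + v)) / 2) :=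
          Real.rpow_le_rpow (by norm_num) (by norm_num) (by linarith)
      _ = 2 ^ (1 - (u + v)) := by
          rw [show (4 : ℝ) = 2 ^ (2 : ℝ) by norm_num, ← Real.rpow_mul (by norm_num)]
          congr 1
          ring
  have hP : 0 ≤ M * N ^ (u + v) := by positivity
  calc N ≤ _ := H
    _ ≤ (3 ^ (1 / 2 - v) * M * N ^ (u + v)) ^ (v / (u + v)) *
        (3 ^ (1 / 2 - u) * M * N ^ (u + v)) ^ (1 - v / (u + v)) :=
      mul_le_mul (Real.rpow_le_rpow hA0 hA hα.le) (Real.rpow_le_rpow hB0 hB (by linarith))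
        (by positivity) (by positivity)
    _ = 3 ^ ((1 / 2 - v) * (v / (u + v)) + (1 / 2 - u) * (1 - v / (u + v))) *
        (M * N ^ (u + v)) := by
      rw [mul_assoc, mul_assoc, Real.mul_rpow (by positivity) hP,
        Real.mul_rpow (by positivity) hP, mul_mul_mul_comm, ← Real.rpow_mul (by norm_num),
        ← Real.rpow_mul (by norm_num), ← Real.rpow_add (by norm_num),
        ← Real.rpow_add_of_nonneg hP hα.le (by linarith), add_sub_cancel, Real.rpow_one]
    _ ≤ 2 ^ (1 - (u + v)) * M * N ^ (u + v) := by
      rw [mul_assoc]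
      exact mul_le_mul_of_nonneg_right hconst hP

theorem BilinBound.sum_rpow_le (h : BilinBound a u v M) (hM : 0 ≤ M) (hu : 0 ≤ u)
    (hv : 0 ≤ v) (huv : 1 / 2 ≤ u + v) (huv1 : u + v < 1) :
    ∑ i, ∑ k, ‖a i k‖ ^ (1 / (1 - u - v)) ≤
      (2 ^ (1 - (u + v)) * M) ^ (1 / (1 - u - v)) := by
  have hl : 0 < 1 - u - v := by linarith
  have hle : M ^ (1 / (1 - u - v)) ≤ (2 ^ (1 - (u + v)) * M) ^ (1 / (1 - u - v)) := by
    refine Real.rpow_le_rpow hM (le_mul_of_one_le_left hM ?_) (by positivity)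
    exact Real.one_le_rpow (by norm_num) (by linarith)
  rcases le_or_gt (1 / 2) v with hv2 | hv2
  · exact (h.sum_rpow_le_of_half_le hM hu hv2 huv1).trans hle
  rcases le_or_gt (1 / 2) u with hu2 | hu2
  · have := h.symm.sum_rpow_le_of_half_le hM hv hu2 (by linarith)
    rw [Finset.sum_comm, show 1 - v - u = 1 - u - v by ring] at this
    exact this.trans hle
  -- Positivity of `u` and `v` is automatic: each is below `1 / 2` and their sum is not.
  · exact h.sum_rpow_le_of_le_half hM (by linarith) (by linarith) hu2.le hv2.le huv huv1

end Bilinear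

/-! ### Multilinear forms -/

/-- The multilinear form with coefficients `a` is bounded by `M` on `ℓ_{1/w_1} × ⋯ × ℓ_{1/w_m}`. -/
def FormBound {𝕜 : Type*} [RCLike 𝕜] {m n : ℕ} (a : (Fin m → Fin n) → 𝕜) (w : Fin m → ℝ)
    (M : ℝ) : Prop :=
  ∀ (x : Fin m → Fin n → 𝕜) (D : Fin m → Fin n → ℝ), (∀ i k, 0 ≤ D i k) →
    (∀ i k, ‖x i k‖ ≤ D i k ^ w i) →
      ‖∑ j, (∏ i, x i (j i)) * a j‖ ≤ M * ∏ i, (∑ k, D i k) ^ w i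

theorem sum_fun_eq_sum_snoc {β : Type*} [AddCommMonoid β] {m n : ℕ}
    (f : (Fin (m + 1) → Fin n) → β) :
    ∑ j, f j = ∑ k, ∑ j : Fin m → Fin n, f (Fin.snoc (α := fun _ => Fin n) j k) := by
  rw [← (Fin.snocEquiv fun _ => Fin n).sum_comp, Fintype.sum_prod_type]
  rfl

section Multilinear

variable {𝕜 : Type*} [RCLike 𝕜] {n : ℕ} {M : ℝ}

theorem FormBound.slice {m : ℕ} {a : (Fin (m + 1) → Fin n) → 𝕜} {w : Fin (m + 1) → ℝ}
    (h : FormBound a w M) {x : Fin n → 𝕜} {D : Fin n → ℝ} (hD : ∀ k, 0 ≤ D k)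
    (hx : ∀ k, ‖x k‖ ≤ D k ^ w (Fin.last m)) :
    FormBound (fun j => ∑ k, x k * a (Fin.snoc (α := fun _ => Fin n) j k))
      (fun i => w i.castSucc) (M * (∑ k, D k) ^ w (Fin.last m)) := by
  intro y E hE hy
  have H := h (Fin.snoc (α := fun _ => Fin n → 𝕜) y x)
    (Fin.snoc (α := fun _ => Fin n → ℝ) E D)
    (fun i => by refine Fin.lastCases ?_ (fun i => ?_) i <;> simp [hE, hD])
    (fun i => by refine Fin.lastCases ?_ (fun i => ?_) i <;> simp [hx, hy])
  rw [sum_fun_eq_sum_snoc, Finset.sum_comm] at H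
  simp only [Fin.prod_univ_castSucc, Fin.snoc_castSucc, Fin.snoc_last] at H
  refine le_trans (le_of_eq ?_) (H.trans_eq (by ring))
  congr 1
  refine Finset.sum_congr rfl fun j _ => ?_
  rw [Finset.mul_sum]
  exact Finset.sum_congr rfl fun k _ => by ring

/-- If every slice of `a` in the last variable is bounded in `ℓ_s` with constant `C`, where
`1 / s = 1 - (w_1 + ⋯ + w_{m-1})` and `s ≥ 2`, then `a` satisfies a mixed inequality with the same
constant. -/
theorem FormBound.sum_rpow_sum_le_of_slice {m : ℕ} {a : (Fin (m + 1) → Fin n) → 𝕜}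
    {w : Fin (m + 1) → ℝ} {C : ℝ} (h : FormBound a w M) (hM : 0 ≤ M) (hC : 0 ≤ C)
    (hw : 0 ≤ w (Fin.last m)) (hs : 1 / 2 ≤ ∑ i : Fin m, w i.castSucc) (hw1 : ∑ i, w i < 1)
    (hslice : ∀ (b : (Fin m → Fin n) → 𝕜) (K : ℝ), 0 ≤ K →
      FormBound b (fun i => w i.castSucc) K →
        ∑ j, ‖b j‖ ^ (1 / (1 - ∑ i : Fin m, w i.castSucc)) ≤
          (C * K) ^ (1 / (1 - ∑ i : Fin m, w i.castSucc))) :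
    ∑ k, (∑ j : Fin m → Fin n, ‖a (Fin.snoc (α := fun _ => Fin n) j k)‖ ^
        (1 / (1 - ∑ i : Fin m, w i.castSucc))) ^
          ((1 - ∑ i : Fin m, w i.castSucc) / (1 - ∑ i, w i)) ≤
      (C * M) ^ (1 / (1 - ∑ i, w i)) := by
  rw [Fin.sum_univ_castSucc] at hw1 ⊢
  set t := ∑ i : Fin m, w i.castSucc with ht
  have ht1 : 0 < 1 - t := by linarith
  have htw : 0 < 1 - (t + w (Fin.last m)) := by linarith
  have e : 1 / (1 - w (Fin.last m) * (1 / (1 - t))) = (1 - t) / (1 - (t + w (Fin.last m))) := by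
    have : 1 - t - w (Fin.last m) ≠ 0 := by linarith
    have : 1 - (t + w (Fin.last m)) ≠ 0 := by linarith
    field_simp
    ring
  have H := sum_rpow_sum_le_of_bound
    (fun (j : Fin m → Fin n) k => a (Fin.snoc (α := fun _ => Fin n) j k)) (s := 1 / (1 - t))
    (w := w (Fin.last m)) (M := C * M) (by rw [le_div_iff₀ ht1]; linarith) hw
    (by rw [mul_one_div, div_lt_one ht1]; linarith) (by positivity) fun x D hD hx => by
      have hS : 0 ≤ ∑ k, D k := Finset.sum_nonneg fun k _ => hD k
      have := hslice _ _ (by positivity) (h.slice hD hx)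
      rwa [← mul_assoc] at this
  rw [e, ← Real.rpow_mul (by positivity)] at H
  refine H.trans_eq ?_
  congr 1
  field_simp

/-- The mixed inequality dominates the unmixed one because its outer exponent is at least the inner
one. This feeds the induction, and the constant stays that of the bilinear case. -/
theorem FormBound.sum_rpow_le {m : ℕ} {a : (Fin (m + 2) → Fin n) → 𝕜} {w : Fin (m + 2) → ℝ}
    (h : FormBound a w M) (hM : 0 ≤ M) (hw : ∀ i, 0 ≤ w i) (hw2 : 1 / 2 ≤ w 0 + w 1)
    (hw1 : ∑ i, w i < 1) :
    ∑ j, ‖a j‖ ^ (1 / (1 - ∑ i, w i)) ≤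
      (2 ^ (1 - (w 0 + w 1)) * M) ^ (1 / (1 - ∑ i, w i)) := by
  induction m generalizing M with
  | zero =>
    simp only [Nat.reduceAdd, Fin.sum_univ_two] at hw1 ⊢
    have hb : BilinBound (fun i k => a ![i, k]) (w 0) (w 1) M := by
      intro y E x D hE hy hD hx
      have H := h ![y, x] ![E, D] (fun i => by fin_cases i <;> simp [hE, hD])
        (fun i => by fin_cases i <;> simp [hx, hy])
      rw [← (finTwoArrowEquiv (Fin n)).symm.sum_comp, Fintype.sum_prod_type] at H
      simpa [Fin.prod_univ_two, mul_assoc] using H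
    have H := hb.sum_rpow_le hM (hw 0) (hw 1) hw2 hw1
    rw [← (finTwoArrowEquiv (Fin n)).symm.sum_comp, Fintype.sum_prod_type,
      show 1 - (w 0 + w 1) = 1 - w 0 - w 1 by ring]
    rw [show 1 - (w 0 + w 1) = 1 - w 0 - w 1 by ring] at H
    simpa using H
  | succ m ih =>
    have hsum : ∑ i, w i = ∑ i : Fin (m + 2), w i.castSucc + w (Fin.last _) :=
      Fin.sum_univ_castSucc _
    have h12 : w 0 + w 1 ≤ ∑ i : Fin (m + 2), w i.castSucc := by
      rw [Fin.sum_univ_succ, Fin.sum_univ_succ, ← add_assoc]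
      exact le_add_of_nonneg_right (Finset.sum_nonneg fun i _ => hw _)
    have hl := hw (Fin.last _)
    have H := h.sum_rpow_sum_le_of_slice (C := 2 ^ (1 - (w 0 + w 1))) hM (by positivity) hl
      (by linarith) hw1 fun b K hK hb => ih hb hK (fun i => hw _) hw2 (by linarith)
    have ht : 0 < 1 - ∑ i : Fin (m + 2), w i.castSucc := by linarith
    have ht' : 0 < 1 - ∑ i, w i := by linarith
    refine le_trans ?_ H
    rw [sum_fun_eq_sum_snoc]
    refine Finset.sum_le_sum fun k _ => ?_
    refine le_trans (le_of_eq (Finset.sum_congr rfl fun j _ => ?_))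
      (sum_rpow_le_rpow_sum_of_one_le (fun j => by positivity) ?_)
    · rw [← Real.rpow_mul (norm_nonneg _)]
      congr 1
      field_simp
    · rw [le_div_iff₀ ht']
      linarith

/-- The unmixed bound controls the slices; the last variable is added without collapsing the two
exponents. -/
theorem FormBound.sum_rpow_sum_le {m : ℕ} {a : (Fin (m + 3) → Fin n) → 𝕜} {w : Fin (m + 3) → ℝ}
    (h : FormBound a w M) (hM : 0 ≤ M) (hw : ∀ i, 0 ≤ w i) (hw2 : 1 / 2 ≤ w 0 + w 1)
    (hw1 : ∑ i, w i < 1) :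
    ∑ k, (∑ j : Fin (m + 2) → Fin n, ‖a (Fin.snoc (α := fun _ => Fin n) j k)‖ ^
        (1 / (1 - ∑ i : Fin (m + 2), w i.castSucc))) ^
          ((1 - ∑ i : Fin (m + 2), w i.castSucc) / (1 - ∑ i, w i)) ≤
      (2 ^ (1 - (w 0 + w 1)) * M) ^ (1 / (1 - ∑ i, w i)) := by
  have hsum : ∑ i, w i = ∑ i : Fin (m + 2), w i.castSucc + w (Fin.last _) :=
    Fin.sum_univ_castSucc _
  have h12 : w 0 + w 1 ≤ ∑ i : Fin (m + 2), w i.castSucc := by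
    rw [Fin.sum_univ_succ, Fin.sum_univ_succ, ← add_assoc]
    exact le_add_of_nonneg_right (Finset.sum_nonneg fun i _ => hw _)
  have hl := hw (Fin.last _)
  exact h.sum_rpow_sum_le_of_slice hM (by positivity) hl (by linarith) hw1 fun b K hK hb =>
    hb.sum_rpow_le hK (fun i => hw _) hw2 (by linarith)

end Multilinear

/-! ### Forms on `ℓ_p` spaces -/

theorem norm_toLp_le_rpow_sum {𝕜 : Type*} [RCLike 𝕜] {n : ℕ} {p : ENNReal} (hp : 1 ≤ p)
    {x : Fin n → 𝕜} {D : Fin n → ℝ} (hD : ∀ k, 0 ≤ D k) (hx : ∀ k, ‖x k‖ ≤ D k ^ recip p) :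
    ‖(WithLp.toLp p x : EllP 𝕜 p n)‖ ≤ (∑ k, D k) ^ recip p := by
  rcases eq_or_ne p ⊤ with rfl | htop
  · rw [PiLp.norm_eq_ciSup]
    refine Real.iSup_le (fun k => ?_) (by simp [recip])
    simpa [recip] using hx k
  · have hp0 : 0 < p.toReal := ENNReal.toReal_pos (by positivity) htop
    rw [PiLp.norm_eq_sum hp0, recip, ENNReal.toReal_inv, one_div]
    refine Real.rpow_le_rpow (by positivity) (Finset.sum_le_sum fun k _ => ?_) (by positivity)
    refine (Real.rpow_le_rpow (norm_nonneg _) (hx k) hp0.le).trans_eq ?_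
    rw [← Real.rpow_mul (hD k), recip, ENNReal.toReal_inv, inv_mul_cancel₀ hp0.ne', Real.rpow_one]

theorem multilinear_apply_eq_sum {𝕜 : Type*} [RCLike 𝕜] {m n : ℕ} (p : Fin m → ENNReal)
    (T : MultilinearMap 𝕜 (fun i => EllP 𝕜 (p i) n) 𝕜) (x : (i : Fin m) → EllP 𝕜 (p i) n) :
    T x = ∑ j : Fin m → Fin n, (∏ i, x i (j i)) * T (fun i => unitVec 𝕜 (p i) n (j i)) := by
  have h : x = fun i => ∑ k : Fin n, x i k • unitVec 𝕜 (p i) n k := by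
    funext i
    ext l
    simp [unitVec, Pi.single_apply]
  conv_lhs => rw [h]
  rw [T.map_sum]
  refine Finset.sum_congr rfl fun j _ => ?_
  rw [T.map_smul_univ (fun i => x i (j i)) (fun i => unitVec 𝕜 (p i) n (j i)), smul_eq_mul]

theorem formBound_contForm {𝕜 : Type*} [RCLike 𝕜] {m n : ℕ} (p : Fin m → ENNReal)
    [∀ i, Fact (1 ≤ p i)] (T : MultilinearMap 𝕜 (fun i => EllP 𝕜 (p i) n) 𝕜) :
    FormBound (fun j => T (fun i => unitVec 𝕜 (p i) n (j i))) (fun i => recip (p i))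
      ‖contForm p T‖ := by
  intro x D hD hx
  have h := (contForm p T).le_opNorm fun i => (WithLp.toLp (p i) (x i) : EllP 𝕜 (p i) n)
  have e : contForm p T (fun i => (WithLp.toLp (p i) (x i) : EllP 𝕜 (p i) n)) =
      ∑ j : Fin m → Fin n, (∏ i, x i (j i)) * T (fun i => unitVec 𝕜 (p i) n (j i)) :=
    multilinear_apply_eq_sum p T _
  rw [e] at h
  refine h.trans (mul_le_mul_of_nonneg_left ?_ (norm_nonneg _))
  exact Finset.prod_le_prod (fun i _ => norm_nonneg _) fun i _ =>
    norm_toLp_le_rpow_sum Fact.out (hD i) (hx i)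


theorem theorem3p4 {𝕜 : Type*} [RCLike 𝕜] (m : ℕ) (hm : 3 ≤ m)
    (p : Fin m → ENNReal) [∀ i, Fact (1 ≤ p i)] (hp : ∀ i, 1 < p i)
    (h12 : 1 / 2 ≤ recip (p ⟨0, by omega⟩) + recip (p ⟨1, by omega⟩))
    (h12' : recip (p ⟨0, by omega⟩) + recip (p ⟨1, by omega⟩) < 1)
    (hsum : ∑ i, recip (p i) < 1)
    (n : ℕ) (hn : 0 < n) (T : MultilinearMap 𝕜 (fun i => EllP 𝕜 (p i) n) 𝕜) :
    (∑ k : Fin n,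
        (∑ j : Fin m → Fin n with j ⟨m - 1, by omega⟩ = k,
          ‖T (fun i => unitVec 𝕜 (p i) n (j i))‖ ^
            (1 / (1 - ∑ i : Fin m with i ≠ ⟨m - 1, by omega⟩, recip (p i)))) ^
          ((1 - ∑ i : Fin m with i ≠ ⟨m - 1, by omega⟩, recip (p i)) /
            (1 - ∑ i, recip (p i)))) ^
        (1 - ∑ i, recip (p i)) ≤
      (2 : ℝ) ^ (1 - (recip (p ⟨0, by omega⟩) + recip (p ⟨1, by omega⟩))) * ‖contForm p T‖ := by
  obtain ⟨m, rfl⟩ : ∃ k, m = k + 3 := ⟨m - 3, by omega⟩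
  have hlast : (⟨m + 3 - 1, by omega⟩ : Fin (m + 3)) = Fin.last (m + 2) := rfl
  have hfilter : ∑ i : Fin (m + 3) with i ≠ Fin.last (m + 2), recip (p i) =
      ∑ i : Fin (m + 2), recip (p i.castSucc) := by
    rw [Finset.sum_filter, Fin.sum_univ_castSucc]
    simp [(Fin.castSucc_lt_last _).ne]
  simp only [hlast, hfilter]
  have hw : ∀ i, 0 ≤ recip (p i) := fun i => ENNReal.toReal_nonneg
  have hr : 0 < 1 - ∑ i, recip (p i) := by linarith
  have H := (formBound_contForm p T).sum_rpow_sum_le (norm_nonneg _) hw h12 hsum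
  have hin : ∀ k : Fin n, ∑ j : Fin (m + 3) → Fin n with j (Fin.last (m + 2)) = k,
      ‖T (fun i => unitVec 𝕜 (p i) n (j i))‖ ^
        (1 / (1 - ∑ i : Fin (m + 2), recip (p i.castSucc))) =
      ∑ j : Fin (m + 2) → Fin n,
        ‖T (fun i => unitVec 𝕜 (p i) n (Fin.snoc (α := fun _ => Fin n) j k i))‖ ^
          (1 / (1 - ∑ i : Fin (m + 2), recip (p i.castSucc))) := by
    intro k
    -- Multi-indices with last entry `k` are exactly those of the form `Fin.snoc j k`.
    rw [Finset.sum_filter, sum_fun_eq_sum_snoc]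
    simp only [Fin.snoc_last]
    rw [Finset.sum_eq_single k (fun b _ hb => by simp [hb]) (by simp)]
    simp
  simp only [hin]
  refine (Real.rpow_le_rpow (by positivity) H hr.le).trans_eq ?_
  rw [← Real.rpow_mul (by positivity), one_div_mul_cancel hr.ne', Real.rpow_one]
  rfl
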